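/- For $n\ge 1$ let $\mathbb Z^n$ act on $2^{\mathbb Z^n}=\{0,1\}^{\mathbb Z^n}$ (with the product topology) by the shift $(g\cdot x)(h)=x(h+g)$, and let $F(2^{\mathbb Z^n})=\{x\in 2^{\mathbb Z^n} : g\cdot x\neq x \text{ for all } g\neq 0\}$ be the free part of this action, with the subspace topology. Regard $F(2^{\mathbb Z^n})$ as a graph (its Cayley graph), in which $x$ and $y$ are adjacent if and only if $y=e_i\cdot x$ or $x=e_i\cdot y$ for some standard generator $e_i$ of $\mathbb Z^n$. A continuous chromatic $k$-coloring is a continuous map $c\colon F(2^{\mathbb Z^n})\to\{0,\dots,k-1\}$ (discrete topology on the target) with $c(x)\neq c(y)$ whenever $x,y$ are adjacent, and the continuous chromatic number of $F(2^{\mathbb Z^n})$ is the least $k$ for which such a coloring exists. Theorem. There is no continuous chromatic $3$-coloring of $F(2^{\mathbb Z^2})$. Moreover, for every $n\geq 2$ the continuous chromatic number of $F(2^{\mathbb Z^n})$ is exactly $4$; that is, $F(2^{\mathbb Z^n})$ has a continuous chromatic $4$-coloring but no continuous chromatic $k$-coloring with $k<4$. -/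

import Mathlib

/-- The shift action of an additive group `G` on `2 ^ G`: `(g · x) (h) = x (h + g)`. -/
def shiftAct {G : Type*} [AddGroup G] (g : G) (x : G → Fin 2) : G → Fin 2 :=
  fun h => x (h + g)

/-- The free part `F(2 ^ G)` of the shift action: the points with trivial stabilizer. As a type it
carries the subspace topology of the product topology on `2 ^ G`, where `2 = Fin 2` is discrete. -/
def freePart (G : Type*) [AddGroup G] : Set (G → Fin 2) :=
  {x | ∀ g : G, g ≠ 0 → shiftAct g x ≠ x}

/-- The standard generator `e i` of `ℤ ^ n`. -/
def stdGen (n : ℕ) (i : Fin n) : Fin n → ℤ := Pi.single i 1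

theorem stdGen_ne_zero (n : ℕ) (i : Fin n) : stdGen n i ≠ 0 := by
  simp [stdGen]

/-- The (undirected) Cayley graph on `F(2 ^ (ℤ ^ n))`: two points are adjacent when one of them is
obtained from the other by the action of one of the standard generators of `ℤ ^ n`. -/
def freeShiftGraph (n : ℕ) : SimpleGraph (freePart (Fin n → ℤ)) where
  Adj x y := ∃ i : Fin n, shiftAct (stdGen n i) x.1 = y.1 ∨ shiftAct (stdGen n i) y.1 = x.1
  symm := ⟨fun _ _ ⟨i, h⟩ => ⟨i, h.symm⟩⟩
  loopless := ⟨fun x ⟨i, h⟩ => x.2 _ (stdGen_ne_zero n i) (h.elim id id)⟩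

/-- The graph `Γ`, on a topological space of vertices, has a continuous chromatic `k`-coloring
(the set `Fin k` of colors is discrete). -/
def ContinuouslyColorable {V : Type*} [TopologicalSpace V] (Γ : SimpleGraph V) (k : ℕ) : Prop :=
  ∃ c : Γ.Coloring (Fin k), Continuous c

/-- The continuous chromatic number: the least `k` such that there is a continuous chromatic
`k`-coloring, and `⊤` if there is none for any `k`. -/
noncomputable def continuousChromaticNumber {V : Type*} [TopologicalSpace V]
    (Γ : SimpleGraph V) : ℕ∞ :=
  ⨅ k ∈ {k : ℕ | ContinuouslyColorable Γ k}, (k : ℕ∞)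

/-! Lower bound. Lift the color change along each edge of a proper 3-coloring to `±1`; the winding
around every unit square is then zero. If one row is colored `p`-periodically, another
`q`-periodically, and all rows between agree at columns `0` and `pq`, the windings `w`, `w'` over
one period satisfy `q w = p w'`. With `p` prime to `q` this gives `p ∣ w`; also `3 ∣ w`, `|w| ≤ p`
and `w ≡ p` mod 2, which is absurd for `p` prime to `6` (`false_of_periodic_rows`). Such rows come
from configurations with two periodic strips wider than the window that the coloring reads. The
configurations for all strip widths lie in one compact subset of the free part
(`stripConfig_aperiodic`), so a single window radius `N` serves them all (`exists_window`), and the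
width can be chosen after it.

Upper bound. A greedy choice ordered by a continuous index marks separated anchors in each orbit and
gives them spheres whose faces are in general position, so that an edge crosses at most one sphere.
One bit is the parity of the number of spheres through a point. An edge preserving it crosses no
sphere (`no_wall_crossed`), so its ends lie in the same balls; the second bit, the parity of the
position relative to the first covering anchor, then changes (`evenPosition_stdGen`). -/

open Filter Topology

/-! ### Supremum norm and shift action. -/

/-- The supremum norm on `ℤ ^ n`, with values in `ℕ`. -/
def latticeNorm {n : ℕ} (g : Fin n → ℤ) : ℕ := Finset.univ.sup fun i => (g i).natAbs

theorem latticeNorm_le {n : ℕ} {g : Fin n → ℤ} {r : ℕ} :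
    latticeNorm g ≤ r ↔ ∀ i, |g i| ≤ r := by
  simp only [latticeNorm, Finset.sup_le_iff, Finset.mem_univ, true_imp_iff]
  exact forall_congr' fun i => by rw [Int.abs_eq_natAbs]; norm_cast

theorem abs_le_latticeNorm {n : ℕ} (g : Fin n → ℤ) (i : Fin n) : |g i| ≤ latticeNorm g :=
  latticeNorm_le.1 le_rfl i

theorem shiftAct_shiftAct {G : Type*} [AddCommGroup G] (g h : G) (x : G → Fin 2) :
    shiftAct g (shiftAct h x) = shiftAct (g + h) x := by
  funext k; simp only [shiftAct, add_assoc]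

theorem shiftAct_mem_freePart {G : Type*} [AddCommGroup G] (g : G) {x : G → Fin 2}
    (hx : x ∈ freePart G) : shiftAct g x ∈ freePart G := by
  intro h hh he
  apply hx h hh
  rw [shiftAct_shiftAct, add_comm, ← shiftAct_shiftAct] at he
  funext k
  have := congrFun he (k - g)
  simpa [shiftAct, add_right_comm] using this

/-! ### Winding numbers of proper 3-colorings. -/

/-- The lift to `{1, -1}` of a nonzero difference of colors in `ℤ/3`. -/
def colorStep (d : ZMod 3) : ℤ := if d = 0 then 0 else if d = 1 then 1 else -1

/-- The winding around a 4-cycle is even, divisible by `3` and at most `4` in absolute value, hence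
zero. -/
theorem colorStep_square : ∀ a b c d : ZMod 3, b ≠ a → c ≠ b → d ≠ a → c ≠ d →
    colorStep (b - a) + colorStep (c - b) = colorStep (d - a) + colorStep (c - d) := by
  decide

theorem colorStep_cast : ∀ d : ZMod 3, ((colorStep d : ℤ) : ZMod 3) = d := by decide

theorem colorStep_abs_le (d : ZMod 3) : |colorStep d| ≤ 1 := by
  revert d; decide

theorem colorStep_odd : ∀ d : ZMod 3, d ≠ 0 → Odd (colorStep d) := by
  decide

/-- The winding of the color sequence `C` along its first `k` steps. -/
def winding (C : ℕ → ZMod 3) (k : ℕ) : ℤ := ∑ u ∈ Finset.range k, colorStep (C (u + 1) - C u)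

theorem winding_cast (C : ℕ → ZMod 3) (k : ℕ) : ((winding C k : ℤ) : ZMod 3) = C k - C 0 := by
  simp only [winding, Int.cast_sum, colorStep_cast]
  exact Finset.sum_range_sub C k

theorem abs_winding_le (C : ℕ → ZMod 3) (k : ℕ) : |winding C k| ≤ k := by
  refine (Finset.abs_sum_le_sum_abs _ _).trans ?_
  refine (Finset.sum_le_sum fun u _ => colorStep_abs_le _).trans ?_
  simp

theorem winding_parity (C : ℕ → ZMod 3) (hC : ∀ u, C (u + 1) ≠ C u) (k : ℕ) :
    Even (winding C k - k) := by
  induction k with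
  | zero => simp [winding]
  | succ k ih =>
    have h := colorStep_odd _ (sub_ne_zero.2 (hC k))
    have : winding C (k + 1) - ((k + 1 : ℕ) : ℤ)
        = (winding C k - k) + (colorStep (C (k + 1) - C k) - 1) := by
      simp only [winding, Finset.sum_range_succ]; push_cast; ring
    rw [this]
    exact ih.add (h.sub_odd odd_one)

theorem winding_mul_of_periodic (C : ℕ → ZMod 3) (p : ℕ) (hC : ∀ u, C (u + p) = C u) (k : ℕ) :
    winding C (k * p) = k * winding C p := by
  have hk : ∀ k u, C (u + k * p) = C u := by
    intro k u
    induction k with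
    | zero => simp
    | succ k ih => rw [Nat.succ_mul, ← add_assoc, hC, ih]
  induction k with
  | zero => simp [winding]
  | succ k ih =>
    have : winding C ((k + 1) * p) = winding C (k * p) + winding C p := by
      rw [Nat.succ_mul]
      simp only [winding, Finset.sum_range_add]
      congr 1
      refine Finset.sum_congr rfl fun u _ => ?_
      rw [add_assoc, add_comm (k * p) (u + 1), add_comm (k * p) u, hk, hk]
    rw [this, ih]; push_cast; ring

theorem winding_succ_row (C : ℕ → ℕ → ZMod 3) (hh : ∀ u v, C (u + 1) v ≠ C u v)
    (hv : ∀ u v, C u (v + 1) ≠ C u v) (v k : ℕ) :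
    winding (C · v) k + colorStep (C k (v + 1) - C k v)
      = colorStep (C 0 (v + 1) - C 0 v) + winding (C · (v + 1)) k := by
  induction k with
  | zero => simp [winding]
  | succ k ih =>
    have := colorStep_square (C k v) (C (k + 1) v) (C (k + 1) (v + 1)) (C k (v + 1))
      (hh _ _) (hv _ _) (hv _ _) (hh _ _)
    simp only [winding, Finset.sum_range_succ] at ih ⊢
    linarith

/-- A proper `3`-coloring of the quarter plane cannot be `p`-periodic on one row and `q`-periodic
on another, with `pq`-periodic rows in between, if `p` is prime to `6` and to `q`. -/
theorem false_of_periodic_rows (C : ℕ → ℕ → ZMod 3) (hh : ∀ u v, C (u + 1) v ≠ C u v)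
    (hv : ∀ u v, C u (v + 1) ≠ C u v) (p q m : ℕ) (hp : Odd p) (h3 : ¬ 3 ∣ p)
    (hpq : Nat.Coprime p q) (ha : ∀ u, C (u + p) 0 = C u 0) (hb : ∀ u, C (u + q) m = C u m)
    (hc : ∀ v ≤ m, C (q * p) v = C 0 v) : False := by
  -- The vertical steps in columns `0` and `pq` coincide, so they cancel between consecutive rows.
  have hrow : ∀ v ≤ m, winding (C · v) (q * p) = winding (C · 0) (q * p) := by
    intro v
    induction v with
    | zero => simp
    | succ v ih =>
      intro hvm
      have h1 := winding_succ_row C hh hv v (q * p)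
      rw [hc v (by omega), hc (v + 1) hvm] at h1
      rw [← ih (by omega)]
      linarith
  have h1 := winding_mul_of_periodic (C · 0) p ha q
  have h2 := winding_mul_of_periodic (C · m) q hb p
  rw [mul_comm p q, hrow m le_rfl, h1] at h2
  have hdvd : (p : ℤ) ∣ winding (C · 0) p := by
    have : (p : ℤ) ∣ q * winding (C · 0) p := ⟨_, h2⟩
    exact (Nat.isCoprime_iff_coprime.2 hpq).dvd_of_dvd_mul_left this
  have h30 : (3 : ℤ) ∣ winding (C · 0) p := by
    rw [← Nat.cast_ofNat (R := ℤ), ← ZMod.intCast_zmod_eq_zero_iff_dvd, winding_cast]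
    have := ha 0
    simp only [zero_add] at this
    simp [this]
  have hcop : IsCoprime (p : ℤ) 3 := by
    have : Nat.Coprime p 3 := ((Nat.Prime.coprime_iff_not_dvd Nat.prime_three).2 h3).symm
    exact_mod_cast Nat.isCoprime_iff_coprime.2 this
  have h3p : (p : ℤ) * 3 ∣ winding (C · 0) p := hcop.mul_dvd hdvd h30
  have hle := abs_winding_le (C · 0) p
  have hp0 := hp.pos
  -- A multiple of `3p` of absolute value at most `p` vanishes; this contradicts the odd parity of
  -- `p` steps.
  have hz : winding (C · 0) p = 0 := by
    apply Int.eq_zero_of_abs_lt_dvd h3p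
    have : (0 : ℤ) < p := by exact_mod_cast hp0
    linarith
  have hpar := winding_parity (C · 0) (fun u => hh u 0) p
  rw [hz, zero_sub, even_neg] at hpar
  have : Even p := by exact_mod_cast hpar
  exact (Nat.not_even_iff_odd.2 hp) this

/-! ### Aperiodic sequences and strip configurations. -/

/-- The parity of the exponent of `2` in `k`. -/
def twoAdicParity (k : ℤ) : ZMod 2 := (padicValInt 2 k : ZMod 2)

theorem twoAdicParity_two_pow_mul (a : ℕ) (j : ℤ) (hj : Odd j) :
    twoAdicParity (2 ^ a * j) = a := by
  have hj0 : j ≠ 0 := by rintro rfl; simp at hj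
  have h1 : padicValInt 2 j = 0 :=
    padicValInt.eq_zero_of_not_dvd (by
      rw [Nat.cast_ofNat, ← even_iff_two_dvd, Int.not_even_iff_odd]; exact hj)
  have h2 : padicValInt 2 ((2 : ℤ) ^ a) = a := by
    have : ((2 : ℤ) ^ a) = ((2 ^ a : ℕ) : ℤ) := by push_cast; rfl
    rw [this, padicValInt.of_nat, padicValNat.prime_pow]
  rw [twoAdicParity, padicValInt.mul (by positivity) hj0, h1, h2, add_zero]

theorem exists_multiple_near (M : ℤ) (hM : 0 < M) (k r : ℤ) :
    ∃ t, k ≤ M * t + r ∧ M * t + r ≤ k + M := by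
  refine ⟨(k - r) / M + 1, ?_, ?_⟩
  · have := Int.lt_mul_ediv_self_add (x := k - r) hM
    nlinarith
  · have := Int.mul_ediv_self_le (x := k - r) hM.ne'
    nlinarith

/-- Write `s = 2^a m` with `m` odd. The 2-adic valuations of `k` and `k + s` are `a` and `a + 2`
when `k ≡ 2^a (4 - m)` mod `8 · 2^a`, and `a + 1` and `a` when `k ≡ 2 · 2^a`. The first progression
keeps the parity, the second flips it. -/
theorem twoAdicParity_shift (s : ℤ) (hs : s ≠ 0) : ∃ L : ℕ, ∀ k₀ : ℤ, ∀ d : ZMod 2,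
    ∃ k, k₀ ≤ k ∧ k ≤ k₀ + L ∧ twoAdicParity (k + s) = twoAdicParity k + d := by
  obtain ⟨a, m, hm, rfl⟩ : ∃ (a : ℕ) (m : ℤ), Odd m ∧ s = 2 ^ a * m := by
    obtain ⟨a, m, hm, h⟩ := (Int.finiteMultiplicity_iff (a := 2) (b := s)).2
      ⟨by decide, hs⟩ |>.exists_eq_pow_mul_and_not_dvd |> fun ⟨c, h1, h2⟩ =>
        (⟨_, c, h2, h1⟩ : ∃ (a : ℕ) (c : ℤ), ¬ 2 ∣ c ∧ s = 2 ^ a * c)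
    exact ⟨a, m, by rwa [← Int.not_even_iff_odd, even_iff_two_dvd], h⟩
  refine ⟨2 ^ a * 8, fun k₀ d => ?_⟩
  obtain ⟨b, hb⟩ := hm
  have hd : d = 0 ∨ d = 1 := by revert d; decide
  rcases hd with rfl | rfl
  · obtain ⟨t, h1, h2⟩ := exists_multiple_near (2 ^ a * 8) (by positivity) k₀ (2 ^ a * (4 - m))
    refine ⟨_, h1, by push_cast; exact h2, ?_⟩
    have e1 : (2 : ℤ) ^ a * 8 * t + 2 ^ a * (4 - m) + 2 ^ a * m = 2 ^ (a + 2) * (2 * t + 1) := by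
      ring
    have e2 : (2 : ℤ) ^ a * 8 * t + 2 ^ a * (4 - m) = 2 ^ a * (2 * (4 * t + 1 - b) + 1) := by
      rw [hb]; ring
    rw [e1, e2, twoAdicParity_two_pow_mul _ _ ⟨_, rfl⟩, twoAdicParity_two_pow_mul _ _ ⟨_, rfl⟩,
      add_zero, Nat.cast_add]
    have : ((2 : ℕ) : ZMod 2) = 0 := by decide
    rw [this, add_zero]
  · obtain ⟨t, h1, h2⟩ := exists_multiple_near (2 ^ a * 8) (by positivity) k₀ (2 ^ a * 2)
    refine ⟨_, h1, by push_cast; exact h2, ?_⟩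
    have e1 : (2 : ℤ) ^ a * 8 * t + 2 ^ a * 2 + 2 ^ a * m
        = 2 ^ a * (2 * (4 * t + 1 + b) + 1) := by
      rw [hb]; ring
    have e2 : (2 : ℤ) ^ a * 8 * t + 2 ^ a * 2 = 2 ^ (a + 1) * (2 * (2 * t) + 1) := by
      ring
    rw [e1, e2, twoAdicParity_two_pow_mul _ _ ⟨_, rfl⟩, twoAdicParity_two_pow_mul _ _ ⟨_, rfl⟩,
      Nat.cast_add, add_assoc]
    have : ((1 : ℕ) : ZMod 2) + 1 = 0 := by decide
    rw [this, add_zero]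

/-- The `v`-th row of a configuration on `ℤ²`: a strip of height `2 N + 1` of period `6 N + 1` and
one of period `6 N + 2` are inserted in the rows `twoAdicParity`. -/
def stripRow (N : ℕ) (v u : ℤ) : ZMod 2 :=
  if -(2 * N + 1 : ℤ) ≤ v ∧ v < 0 then twoAdicParity (u % (6 * N + 1 : ℤ))
  else if 0 ≤ v ∧ v ≤ 2 * N then twoAdicParity (u % (6 * N + 2 : ℤ))
  else twoAdicParity u

/-- The bound must not depend on `N`: strips with `N < L` are left altogether, and thicker ones have
room away from their borders. -/
theorem stripRow_locally_const (L : ℕ) : ∃ B : ℕ, ∀ (N : ℕ) (v₀ : ℤ), ∃ a : ℤ, |a - v₀| ≤ B ∧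
    ∀ v, a ≤ v → v ≤ a + L → ∀ u, stripRow N v u = stripRow N a u := by
  refine ⟨5 * L + 5, fun N v₀ => ?_⟩
  suffices h : ∃ a : ℤ, |a - v₀| ≤ (5 * L + 5 : ℕ) ∧ ∀ v, a ≤ v → v ≤ a + L →
      ((-(2 * N + 1 : ℤ) ≤ v ∧ v < 0) ↔ (-(2 * N + 1 : ℤ) ≤ a ∧ a < 0)) ∧
      ((0 ≤ v ∧ v ≤ 2 * N) ↔ (0 ≤ a ∧ a ≤ 2 * N)) by
    obtain ⟨a, h1, h2⟩ := h
    refine ⟨a, h1, fun v h3 h4 u => ?_⟩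
    simp only [stripRow, (h2 v h3 h4).1, (h2 v h3 h4).2]
  simp only [abs_le]
  by_cases h1 : v₀ > 2 * N
  · exact ⟨v₀, by omega, fun v _ _ => by omega⟩
  by_cases h2 : v₀ < -(2 * N + 1)
  · exact ⟨v₀ - L, by omega, fun v _ _ => by omega⟩
  by_cases h3 : N < L
  · exact ⟨2 * N + 1, by omega, fun v _ _ => by omega⟩
  by_cases h4 : (v₀ < 0 ∧ v₀ + L < 0) ∨ (0 ≤ v₀ ∧ v₀ + L ≤ 2 * N)
  · exact ⟨v₀, by omega, fun v _ _ => by omega⟩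
  · exact ⟨v₀ - L, by omega, fun v _ _ => by omega⟩

/-- A period `P` this long has, near every residue, an interval of candidates `k` for which neither
`k` nor `k + s` wraps around, so the reduction is invisible there. -/
theorem twoAdicParity_emod_shift {s : ℤ} {L : ℕ}
    (hL : ∀ k₀ : ℤ, ∃ k, k₀ ≤ k ∧ k ≤ k₀ + L ∧ twoAdicParity (k + s) ≠ twoAdicParity k)
    (P : ℤ) (hP : 6 * (L + |s|) < P) (u₀ : ℤ) : ∃ u, |u - u₀| ≤ L + |s| ∧
      twoAdicParity ((u + s) % P) ≠ twoAdicParity (u % P) := by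
  have hs1 := le_abs_self s
  have hs2 := neg_abs_le s
  have hs3 := abs_nonneg s
  have hw0 := Int.emod_nonneg u₀ (show P ≠ 0 by omega)
  have hw1 := Int.emod_lt_of_pos u₀ (show 0 < P by omega)
  have hu := Int.emod_add_mul_ediv u₀ P
  generalize |s| = S at *
  generalize u₀ % P = w at *
  have key : ∃ k₀ : ℤ, S ≤ k₀ ∧ k₀ + L + S < P ∧ w - L - S ≤ k₀ ∧ k₀ ≤ w + S := by
    by_cases h : w + L + 2 * S < P
    · exact ⟨w + S, by omega⟩
    · exact ⟨w - L - S, by omega⟩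
  obtain ⟨k₀, h1, h2, h3, h4⟩ := key
  obtain ⟨k, h5, h6, h7⟩ := hL k₀
  refine ⟨k + P * (u₀ / P), ?_, ?_⟩
  · rw [abs_le]; generalize P * (u₀ / P) = z at *; omega
  · rw [show k + P * (u₀ / P) + s = (k + s) + P * (u₀ / P) by ring, Int.add_mul_emod_self_left,
      Int.add_mul_emod_self_left, Int.emod_eq_of_lt (by omega) (by omega),
      Int.emod_eq_of_lt (by omega) (by omega)]
    exact h7

/-- Again uniformly in `N`: thin strips are left vertically, and otherwise the periods exceed `6 (L
+ |s|)`, as `twoAdicParity_emod_shift` requires. -/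
theorem stripRow_aperiodic {s : ℤ} (hs : s ≠ 0) : ∃ B : ℕ, ∀ (N : ℕ) (u₀ v₀ : ℤ), ∃ u v : ℤ,
    |u - u₀| ≤ B ∧ |v - v₀| ≤ B ∧ stripRow N v (u + s) ≠ stripRow N v u := by
  obtain ⟨L, hL⟩ := twoAdicParity_shift s hs
  have hL' : ∀ k₀ : ℤ, ∃ k, k₀ ≤ k ∧ k ≤ k₀ + L ∧ twoAdicParity (k + s) ≠ twoAdicParity k := by
    intro k₀
    obtain ⟨k, h1, h2, h3⟩ := hL k₀ 1
    refine ⟨k, h1, h2, ?_⟩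
    rw [h3]; simp
  have hs3 := abs_nonneg s
  refine ⟨6 * (L + s.natAbs) + 6, fun N u₀ v₀ => ?_⟩
  have hB : ((6 * (L + s.natAbs) + 6 : ℕ) : ℤ) = 6 * (L + |s|) + 6 := by
    push_cast; ring
  rw [hB]
  by_cases hN : (N : ℤ) < L + |s|
  · obtain ⟨u, h1, h2, h3⟩ := hL' u₀
    have hv : ∃ v : ℤ, |v - v₀| ≤ 6 * (L + |s|) + 6 ∧ (v < -(2 * N + 1) ∨ 2 * N < v) := by
      simp only [abs_le]
      by_cases h : v₀ < -(2 * N + 1) ∨ 2 * N < v₀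
      · exact ⟨v₀, by omega, h⟩
      · exact ⟨2 * N + 1, by omega, by omega⟩
    obtain ⟨v, hv1, hv2⟩ := hv
    refine ⟨u, v, by rw [abs_le]; omega, hv1, ?_⟩
    have c1 : ¬ (-(2 * N + 1 : ℤ) ≤ v ∧ v < 0) := by omega
    have c2 : ¬ (0 ≤ v ∧ v ≤ 2 * (N : ℤ)) := by omega
    simpa only [stripRow, c1, c2, if_false] using h3
  · by_cases c1 : (-(2 * N + 1 : ℤ) ≤ v₀ ∧ v₀ < 0)
    · obtain ⟨u, h1, h2⟩ := twoAdicParity_emod_shift hL' (6 * N + 1) (by omega) u₀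
      exact ⟨u, v₀, by omega, by simp; omega, by simpa only [stripRow, if_pos c1] using h2⟩
    by_cases c2 : (0 ≤ v₀ ∧ v₀ ≤ 2 * (N : ℤ))
    · obtain ⟨u, h1, h2⟩ := twoAdicParity_emod_shift hL' (6 * N + 2) (by omega) u₀
      exact ⟨u, v₀, by omega, by simp; omega,
        by simpa only [stripRow, if_neg c1, if_pos c2] using h2⟩
    · obtain ⟨u, h1, h2, h3⟩ := hL' u₀
      exact ⟨u, v₀, by rw [abs_le]; omega, by simp; omega,
        by simpa only [stripRow, if_neg c1, if_neg c2] using h3⟩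

/-- The configuration on `ℤ ^ n` with rows `stripRow N` in the plane of coordinates `i₀`, `i₁`,
twisted by `twoAdicParity` in all coordinates but `i₀`. -/
def stripConfig {n : ℕ} (i₀ i₁ : Fin n) (N : ℕ) (g : Fin n → ℤ) : ZMod 2 :=
  stripRow N (g i₁) (g i₀) + ∑ j ∈ Finset.univ.erase i₀, twoAdicParity (g j)

theorem stripConfig_aperiodic {n : ℕ} {i₀ i₁ : Fin n} (hi : i₁ ≠ i₀) {s : Fin n → ℤ}
    (hs : s ≠ 0) : ∃ r : ℕ, ∀ (N : ℕ) (g : Fin n → ℤ), ∃ t : Fin n → ℤ,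
      latticeNorm t ≤ r ∧ stripConfig i₀ i₁ N (g + t + s) ≠ stripConfig i₀ i₁ N (g + t) := by
  by_cases h : ∃ j, j ≠ i₀ ∧ s j ≠ 0
  · obtain ⟨j, hj, hsj⟩ := h
    obtain ⟨L, hL⟩ := twoAdicParity_shift (s j) hsj
    obtain ⟨B, hB⟩ := stripRow_locally_const (L + 2 * (s j).natAbs)
    refine ⟨B + L + (s j).natAbs, fun N g => ?_⟩
    obtain ⟨a, ha, hc⟩ := hB N (g j)
    have hs1 := le_abs_self (s j)
    have hs2 := neg_abs_le (s j)
    have hcast : ((L + 2 * (s j).natAbs : ℕ) : ℤ) = L + 2 * |s j| := by push_cast; rfl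
    have hcast' : ((B + L + (s j).natAbs : ℕ) : ℤ) = B + L + |s j| := by push_cast; rfl
    rw [hcast] at hc
    set T := (Finset.univ.erase i₀).erase j with hT
    set E₁ := ∑ i ∈ T, twoAdicParity (g i + s i) with hE₁
    set E₂ := ∑ i ∈ T, twoAdicParity (g i) with hE₂
    set P₁ := stripRow N (if i₁ = j then a else g i₁ + s i₁) (g i₀ + s i₀) with hP₁
    set P₂ := stripRow N (if i₁ = j then a else g i₁) (g i₀) with hP₂
    -- Moving along coordinate `j` only, all other contributions stay fixed; this prescribed change
    -- makes the total difference equal to `1`. The margin `|s j|` keeps `k` and `k + s j` among the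
    -- rows where the strip pattern is constant.
    obtain ⟨k, hk1, hk2, hk3⟩ := hL (a + |s j|) (1 + P₁ + P₂ + E₁ + E₂)
    have hsum : ∀ f : Fin n → ZMod 2, ∑ i ∈ Finset.univ.erase i₀, f i = f j + ∑ i ∈ T, f i :=
      fun f => (Finset.add_sum_erase _ _ (by simp [hj])).symm
    refine ⟨Pi.single j (k - g j), ?_, ?_⟩
    · rw [latticeNorm_le]
      intro i
      rw [hcast']
      rcases eq_or_ne i j with rfl | hij
      · rw [Pi.single_eq_same]
        rw [abs_le] at ha ⊢
        omega
      · rw [Pi.single_eq_of_ne hij]; simp; positivity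
    · have e1 : stripConfig i₀ i₁ N (g + Pi.single j (k - g j) + s)
          = P₁ + ((twoAdicParity k + (1 + P₁ + P₂ + E₁ + E₂)) + E₁) := by
        rw [stripConfig, hsum]
        congr 1
        · rw [hP₁]
          simp only [Pi.add_apply, Pi.single_eq_of_ne hj.symm, add_zero]
          split_ifs with hij
          · subst hij
            rw [Pi.single_eq_same]
            apply hc <;> omega
          · rw [Pi.single_eq_of_ne hij, add_zero]
        · congr 1
          · rw [← hk3]; simp
          · refine Finset.sum_congr rfl fun i hi => ?_
            simp [Pi.single_eq_of_ne (Finset.ne_of_mem_erase hi)]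
      have e2 : stripConfig i₀ i₁ N (g + Pi.single j (k - g j))
          = P₂ + (twoAdicParity k + E₂) := by
        rw [stripConfig, hsum]
        congr 1
        · rw [hP₂]
          simp only [Pi.add_apply, Pi.single_eq_of_ne hj.symm, add_zero]
          split_ifs with hij
          · subst hij
            rw [Pi.single_eq_same]
            apply hc <;> omega
          · rw [Pi.single_eq_of_ne hij, add_zero]
        · congr 1
          · simp
          · refine Finset.sum_congr rfl fun i hi => ?_
            simp [Pi.single_eq_of_ne (Finset.ne_of_mem_erase hi)]
      rw [e1, e2]
      have : ∀ p₁ p₂ x y b : ZMod 2, p₁ + ((b + (1 + p₁ + p₂ + x + y)) + x) ≠ p₂ + (b + y) := by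
        decide
      exact this _ _ _ _ _
  · push Not at h
    have hs0 : s i₀ ≠ 0 := by
      intro h0
      apply hs
      funext j
      rcases eq_or_ne j i₀ with rfl | hj
      · exact h0
      · exact h j hj
    obtain ⟨B, hB⟩ := stripRow_aperiodic hs0
    refine ⟨B, fun N g => ?_⟩
    obtain ⟨u, v, hu, hv, huv⟩ := hB N (g i₀) (g i₁)
    set t : Fin n → ℤ := Pi.single i₀ (u - g i₀) + Pi.single i₁ (v - g i₁) with ht
    have ht₀ : t i₀ = u - g i₀ := by simp [ht, Pi.single_eq_of_ne hi.symm]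
    have ht₁ : t i₁ = v - g i₁ := by simp [ht, Pi.single_eq_of_ne hi]
    refine ⟨t, ?_, ?_⟩
    · rw [latticeNorm_le]
      intro i
      rcases eq_or_ne i i₀ with rfl | h0
      · rwa [ht₀]
      rcases eq_or_ne i i₁ with rfl | h1
      · rwa [ht₁]
      · simp [ht, Pi.single_eq_of_ne h0, Pi.single_eq_of_ne h1]
    · have hsum : ∑ j ∈ Finset.univ.erase i₀, twoAdicParity ((g + t + s) j)
          = ∑ j ∈ Finset.univ.erase i₀, twoAdicParity ((g + t) j) :=
        Finset.sum_congr rfl fun j hj => by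
          rw [Pi.add_apply _ s, h j (Finset.ne_of_mem_erase hj), add_zero]
      rw [stripConfig, stripConfig, hsum]
      intro he
      apply huv
      simpa [ht₀, ht₁, h i₁ hi] using add_right_cancel he

/-! ### Compactness and uniform windows. -/

theorem finite_latticeNorm_le (n r : ℕ) : {t : Fin n → ℤ | latticeNorm t ≤ r}.Finite := by
  refine (Set.finite_Icc (fun _ => -(r : ℤ)) (fun _ => (r : ℤ))).subset fun t ht => ?_
  have := latticeNorm_le.1 ht
  exact ⟨fun i => (abs_le.1 (this i)).1, fun i => (abs_le.1 (this i)).2⟩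

theorem Continuous.eventually_eq_of_discrete {X Y : Type*} [TopologicalSpace X]
    [TopologicalSpace Y] [DiscreteTopology Y] {f : X → Y} (hf : Continuous f) (x : X) :
    ∀ᶠ y in 𝓝 x, f y = f x :=
  ((isOpen_discrete {f x}).preimage hf).mem_nhds rfl

theorem eventually_eq_on_box {n : ℕ} (x : (Fin n → ℤ) → Fin 2) (N : ℕ) :
    ∀ᶠ y in 𝓝 x, ∀ h, latticeNorm h ≤ N → y h = x h := by
  refine (eventually_all_finite (finite_latticeNorm_le n N)).2 fun h _ => ?_
  exact (continuous_apply (A := fun _ : Fin n → ℤ => Fin 2) h).eventually_eq_of_discrete x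

theorem exists_window_at {n : ℕ} {α : Type*} [TopologicalSpace α] [DiscreteTopology α]
    {c : freePart (Fin n → ℤ) → α} (hc : Continuous c) (x : freePart (Fin n → ℤ)) :
    ∃ N : ℕ, ∀ y : freePart (Fin n → ℤ), (∀ h, latticeNorm h ≤ N → y.1 h = x.1 h) → c y = c x := by
  have h1 : {y | c y = c x} ∈ 𝓝 x := hc.eventually_eq_of_discrete x
  rw [nhds_subtype_eq_comap, mem_comap] at h1
  obtain ⟨U, hU, hUc⟩ := h1
  rw [nhds_pi, mem_pi] at hU
  obtain ⟨I, hI, t, ht, hsub⟩ := hU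
  refine ⟨hI.toFinset.sup latticeNorm, fun y hy => hUc (hsub fun i hi => ?_)⟩
  rw [hy i (Finset.le_sup (f := latticeNorm) (hI.mem_toFinset.2 hi))]
  exact mem_of_mem_nhds (ht i)

theorem exists_window {n : ℕ} {α : Type*} [TopologicalSpace α] [DiscreteTopology α]
    {c : freePart (Fin n → ℤ) → α} (hc : Continuous c) {K : Set ((Fin n → ℤ) → Fin 2)}
    (hK : IsClosed K) (hKF : K ⊆ freePart (Fin n → ℤ)) :
    ∃ N : ℕ, ∀ x y : freePart (Fin n → ℤ), x.1 ∈ K →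
      (∀ h, latticeNorm h ≤ N → y.1 h = x.1 h) → c y = c x := by
  have hex : ∀ x : (Fin n → ℤ) → Fin 2, ∃ N : ℕ, ∀ hx : x ∈ freePart (Fin n → ℤ),
      ∀ y : freePart (Fin n → ℤ), (∀ h, latticeNorm h ≤ N → y.1 h = x h) → c y = c ⟨x, hx⟩ := by
    intro x
    by_cases hx : x ∈ freePart (Fin n → ℤ)
    · obtain ⟨N, hN⟩ := exists_window_at hc ⟨x, hx⟩
      exact ⟨N, fun _ => hN⟩
    · exact ⟨0, fun h => absurd h hx⟩
  choose w hw using hex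
  -- Finitely many cylinders cover `K`. Agreement with `x` on the largest of their boxes puts `y` in
  -- the same cylinder as `x`, even if `y` is outside `K`.
  obtain ⟨T, hTK, hT⟩ := hK.isCompact.elim_nhds_subcover
    (fun x => {y | ∀ h, latticeNorm h ≤ w x → y h = x h})
    fun x _ => eventually_eq_on_box x (w x)
  refine ⟨T.sup w, fun x y hx hxy => ?_⟩
  obtain ⟨z, hzT, hz⟩ := Set.mem_iUnion₂.1 (hT hx)
  have hzF := hKF (hTK z hzT)
  rw [hw z hzF x hz]
  exact hw z hzF y fun h hh =>
    (hxy h (hh.trans (Finset.le_sup (f := w) hzT))).trans (hz h hh)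

/-- The configurations which differ from their shift by `s` within distance `r s` of each point. -/
def uniformlyAperiodic {n : ℕ} (r : (Fin n → ℤ) → ℕ) : Set ((Fin n → ℤ) → Fin 2) :=
  {x | ∀ s, s ≠ 0 → ∀ g, ∃ t, latticeNorm t ≤ r s ∧ x (g + t + s) ≠ x (g + t)}

theorem uniformlyAperiodic_subset {n : ℕ} (r : (Fin n → ℤ) → ℕ) :
    uniformlyAperiodic r ⊆ freePart (Fin n → ℤ) := by
  intro x hx s hs he
  obtain ⟨t, -, ht⟩ := hx s hs 0
  exact ht (congrFun he (0 + t))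

/-- Bounding the witness `t` makes the union finite, which is what the free part itself lacks. -/
theorem isClosed_uniformlyAperiodic {n : ℕ} (r : (Fin n → ℤ) → ℕ) :
    IsClosed (uniformlyAperiodic r) := by
  have : uniformlyAperiodic r = ⋂ (s : Fin n → ℤ) (_ : s ≠ 0) (g : Fin n → ℤ),
      ⋃ t ∈ {t : Fin n → ℤ | latticeNorm t ≤ r s}, {x | x (g + t + s) ≠ x (g + t)} := by
    ext x; simp [uniformlyAperiodic]
  rw [this]
  refine isClosed_iInter fun s => isClosed_iInter fun _ => isClosed_iInter fun g =>
    (finite_latticeNorm_le n (r s)).isClosed_biUnion fun t _ => ?_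
  have hcont : Continuous fun x : (Fin n → ℤ) → Fin 2 => (x (g + t + s), x (g + t)) := by fun_prop
  exact (isClosed_discrete {b : Fin 2 × Fin 2 | b.1 ≠ b.2}).preimage hcont

theorem shiftAct_mem_uniformlyAperiodic {n : ℕ} {r : (Fin n → ℤ) → ℕ} (g : Fin n → ℤ)
    {x : (Fin n → ℤ) → Fin 2} (hx : x ∈ uniformlyAperiodic r) :
    shiftAct g x ∈ uniformlyAperiodic r := by
  intro s hs h
  obtain ⟨t, ht, hne⟩ := hx s hs (h + g)
  refine ⟨t, ht, ?_⟩
  simp only [shiftAct]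
  convert hne using 2 <;> abel_nf

/-! ### The lower bound. -/

theorem not_continuouslyColorable_three {n : ℕ} {i₀ i₁ : Fin n} (hi : i₁ ≠ i₀) :
    ¬ ContinuouslyColorable (freeShiftGraph n) 3 := by
  rintro ⟨c, hc⟩
  choose! r hr using fun (s : Fin n → ℤ) (hs : s ≠ 0) => stripConfig_aperiodic hi hs
  obtain ⟨N, hN⟩ := exists_window hc (isClosed_uniformlyAperiodic r) (uniformlyAperiodic_subset r)
  let X : (Fin n → ℤ) → Fin 2 := stripConfig i₀ i₁ N
  have hX : X ∈ uniformlyAperiodic r := fun s hs g => hr s hs N g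
  -- The offset makes rows `0` and `2N + 1` the middle rows of the two strips, so their windows of
  -- radius `N` fill exactly one strip each.
  let pos : ℕ → ℕ → Fin n → ℤ := fun u v => Pi.single i₀ (u : ℤ) + Pi.single i₁ ((v : ℤ) - N - 1)
  have pos₀ : ∀ u v, pos u v i₀ = u := fun u v => by simp [pos, Pi.single_eq_of_ne hi.symm]
  have pos₁ : ∀ u v, pos u v i₁ = v - N - 1 := fun u v => by simp [pos, Pi.single_eq_of_ne hi]
  have posj : ∀ u u' v j, j ≠ i₀ → pos u v j = pos u' v j := fun u u' v j hj => by
    simp [pos, Pi.single_eq_of_ne hj]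
  let pt : ℕ → ℕ → freePart (Fin n → ℤ) := fun u v =>
    ⟨shiftAct (pos u v) X, shiftAct_mem_freePart _ (uniformlyAperiodic_subset r hX)⟩
  let C : ℕ → ℕ → ZMod 3 := fun u v => c (pt u v)
  -- The twist ignores coordinate `i₀`, so horizontal translations only affect the strip rows.
  have hper : ∀ u u' v : ℕ, (∀ k l : ℤ, |k| ≤ N →
      stripRow N (k + (v - N - 1)) (l + u') = stripRow N (k + (v - N - 1)) (l + u)) →
      C u' v = C u v := by
    intro u u' v h
    refine hN (pt u v) (pt u' v) (shiftAct_mem_uniformlyAperiodic _ hX) fun g hg => ?_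
    change stripConfig i₀ i₁ N (g + pos u' v) = stripConfig i₀ i₁ N (g + pos u v)
    simp only [stripConfig, Pi.add_apply, pos₀, pos₁]
    rw [h _ _ (latticeNorm_le.1 hg i₁)]
    congr 1
    exact Finset.sum_congr rfl fun j hj => by rw [posj u' u v j (Finset.ne_of_mem_erase hj)]
  have hadj : ∀ (i : Fin n) (u v u' v' : ℕ), pos u' v' = stdGen n i + pos u v → C u' v' ≠ C u v := by
    intro i u v u' v' h
    refine (c.valid (v := pt u v) (w := pt u' v') ⟨i, Or.inl ?_⟩).symm
    change shiftAct (stdGen n i) (shiftAct (pos u v) X) = shiftAct (pos u' v') X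
    rw [shiftAct_shiftAct, h]
  have hemod : ∀ (k P m : ℤ), (k + m * P) % P = k % P := fun k P m => Int.add_mul_emod_self_right ..
  refine false_of_periodic_rows C (fun u v => hadj i₀ u v _ _ ?_) (fun u v => hadj i₁ u v _ _ ?_)
    (6 * N + 1) (6 * N + 2) (2 * N + 1) ⟨3 * N, by ring⟩ (by omega) ?_ ?_ ?_ ?_
  · funext j
    simp only [pos, stdGen, Pi.add_apply, Pi.single_apply]
    split_ifs <;> push_cast <;> ring
  · funext j
    simp only [pos, stdGen, Pi.add_apply, Pi.single_apply]
    split_ifs <;> push_cast <;> ring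
  · exact (Nat.coprime_self_add_right (m := 6 * N + 1) (n := 1)).2 (Nat.coprime_one_right _)
  · refine fun u => hper _ _ _ fun k l hk => ?_
    rw [abs_le] at hk
    have c1 : -(2 * N + 1 : ℤ) ≤ k + ((0 : ℕ) - N - 1) ∧ k + ((0 : ℕ) - N - 1) < 0 := by omega
    rw [stripRow, stripRow, if_pos c1, if_pos c1, ← hemod (l + u) _ 1]
    congr 2; push_cast; ring
  · refine fun u => hper _ _ _ fun k l hk => ?_
    rw [abs_le] at hk
    have c1 : ¬ (-(2 * N + 1 : ℤ) ≤ k + ((2 * N + 1 : ℕ) - N - 1) ∧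
      k + ((2 * N + 1 : ℕ) - N - 1) < 0) := by omega
    have c2 : 0 ≤ k + ((2 * N + 1 : ℕ) - N - 1 : ℤ) ∧
      k + ((2 * N + 1 : ℕ) - N - 1) ≤ 2 * (N : ℤ) := by omega
    rw [stripRow, stripRow, if_neg c1, if_neg c1, if_pos c2, if_pos c2, ← hemod (l + u) _ 1]
    congr 2; push_cast; ring
  -- Every window between the middle rows stays inside the two strips, both of which are
  -- `pq`-periodic; the third branch is empty.
  · refine fun v hv => hper _ _ _ fun k l hk => ?_
    rw [abs_le] at hk
    simp only [stripRow]
    split_ifs with c1 c2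
    · rw [← hemod (l + (0 : ℕ)) _ (6 * N + 2)]
      congr 2; push_cast; ring
    · rw [← hemod (l + (0 : ℕ)) _ (6 * N + 1)]
      congr 2; push_cast; ring
    · omega

/-! ### A continuous index separating nearby points of an orbit. -/

/-- The shift action on the free part. -/
def freeShift {G : Type*} [AddCommGroup G] (g : G) (x : freePart G) : freePart G :=
  ⟨shiftAct g x.1, shiftAct_mem_freePart g x.2⟩

theorem freeShift_freeShift {G : Type*} [AddCommGroup G] (g h : G) (x : freePart G) :
    freeShift g (freeShift h x) = freeShift (g + h) x :=
  Subtype.ext (shiftAct_shiftAct g h x.1)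

theorem freeShift_zero {G : Type*} [AddCommGroup G] (x : freePart G) : freeShift 0 x = x := by
  apply Subtype.ext; funext h; simp [freeShift, shiftAct]

theorem continuous_freeShift {G : Type*} [AddCommGroup G] (g : G) :
    Continuous (freeShift g : freePart G → freePart G) := by
  refine Continuous.subtype_mk (continuous_pi fun h => ?_) _
  exact (continuous_apply (h + g)).comp continuous_subtype_val

theorem eventually_freeShift {n : ℕ} {α : Type*} {f : freePart (Fin n → ℤ) → α}
    (x : freePart (Fin n → ℤ)) (g : Fin n → ℤ)
    (hf : ∀ᶠ y in 𝓝 (freeShift g x), f y = f (freeShift g x)) :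
    ∀ᶠ y in 𝓝 x, f (freeShift g y) = f (freeShift g x) :=
  (continuous_freeShift g).continuousAt.eventually hf

theorem latticeNorm_neg {n : ℕ} (g : Fin n → ℤ) : latticeNorm (-g) = latticeNorm g := by
  simp [latticeNorm]

theorem latticeNorm_zero (n : ℕ) : latticeNorm (0 : Fin n → ℤ) = 0 := by
  rw [← Nat.le_zero, latticeNorm_le]; simp

theorem latticeNorm_add_le {n : ℕ} (g h : Fin n → ℤ) :
    latticeNorm (g + h) ≤ latticeNorm g + latticeNorm h := by
  rw [latticeNorm_le]
  intro i
  push_cast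
  exact (abs_add_le _ _).trans (add_le_add (abs_le_latticeNorm g i) (abs_le_latticeNorm h i))

theorem latticeNorm_sub_le {n : ℕ} (g h : Fin n → ℤ) :
    latticeNorm (g - h) ≤ latticeNorm g + latticeNorm h := by
  rw [sub_eq_add_neg, ← latticeNorm_neg h]; exact latticeNorm_add_le _ _

theorem exists_separating_window {n : ℕ} (R : ℕ) (x : freePart (Fin n → ℤ)) :
    ∃ m : ℕ, ∀ g, g ≠ 0 → latticeNorm g ≤ R → ∃ h, latticeNorm h ≤ m ∧ x.1 (h + g) ≠ x.1 h := by
  have : ∀ g : Fin n → ℤ, ∃ h, g ≠ 0 → x.1 (h + g) ≠ x.1 h := by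
    intro g
    by_cases hg : g = 0
    · exact ⟨0, fun h => absurd hg h⟩
    · obtain ⟨h, hh⟩ := Function.ne_iff.1 (x.2 g hg)
      exact ⟨h, fun _ => hh⟩
  choose w hw using this
  refine ⟨(finite_latticeNorm_le n R).toFinset.sup fun g => latticeNorm (w g),
    fun g hg hgR => ⟨w g, ?_, hw g hg⟩⟩
  exact Finset.le_sup (f := fun g => latticeNorm (w g)) ((Set.Finite.mem_toFinset _).2 hgR)

open Classical in
/-- A continuous proper coloring, with colors in `ℕ`, of the graph of points of the same orbit at
distance at most `R`. -/
theorem exists_continuous_index (n R : ℕ) : ∃ j : freePart (Fin n → ℤ) → ℕ, Continuous j ∧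
    ∀ x g, g ≠ 0 → latticeNorm g ≤ R → j (freeShift g x) ≠ j x := by
  -- The index encodes the least radius `m x` separating `x` from its short translates, with the
  -- pattern of `x` on that box.
  obtain ⟨f, hf⟩ := Countable.exists_injective_nat (ℕ × Finset (Fin n → ℤ))
  let m : freePart (Fin n → ℤ) → ℕ := fun x => Nat.find (exists_separating_window R x)
  have hm : ∀ x : freePart (Fin n → ℤ), ∀ g, g ≠ 0 → latticeNorm g ≤ R →
      ∃ h, latticeNorm h ≤ m x ∧ x.1 (h + g) ≠ x.1 h :=
    fun x => Nat.find_spec (exists_separating_window R x)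
  let S : freePart (Fin n → ℤ) → Finset (Fin n → ℤ) := fun x =>
    (finite_latticeNorm_le n (m x)).toFinset.filter fun h => x.1 h = 1
  have hS : ∀ x h, h ∈ S x ↔ latticeNorm h ≤ m x ∧ x.1 h = 1 := fun x h => by simp [S]
  refine ⟨fun x => f (m x, S x), ?_, ?_⟩
  · refine (IsLocallyConstant.iff_eventually_eq _ |>.2 fun x => ?_).continuous
    -- Testing the radius `m x` reads `h + g` with `h` of norm at most `m x` and `g` of norm at most
    -- `R`.
    have hev := continuous_subtype_val.continuousAt.eventually
      (eventually_eq_on_box x.1 (m x + R))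
    filter_upwards [hev] with y hy
    have h1 : m y ≤ m x := by
      refine Nat.find_min' _ fun g hg hgR => ?_
      obtain ⟨h, hh, hne⟩ := hm x g hg hgR
      refine ⟨h, hh, ?_⟩
      rw [hy _ ((latticeNorm_add_le h g).trans (add_le_add hh hgR)), hy _ (by omega)]
      exact hne
    have h2 : m x ≤ m y := by
      refine Nat.find_min' _ fun g hg hgR => ?_
      obtain ⟨h, hh, hne⟩ := hm y g hg hgR
      refine ⟨h, hh, ?_⟩
      rw [← hy _ ((latticeNorm_add_le h g).trans (add_le_add (hh.trans h1) hgR)),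
        ← hy _ (by omega)]
      exact hne
    have h3 : m y = m x := le_antisymm h1 h2
    have h4 : S y = S x := by
      ext h
      rw [hS, hS, h3]
      exact and_congr_right fun hh => by rw [hy _ (by omega)]
    rw [h3, h4]
  · intro x g hg hgR he
    obtain ⟨h1, h2⟩ := Prod.ext_iff.1 (hf he)
    simp only at h1 h2
    obtain ⟨h, hh, hne⟩ := hm x g hg hgR
    -- Equal indices would give `x` and its translate the same pattern on a box that separates them.
    have h3 := hS (freeShift g x) h
    rw [h2, hS, h1] at h3
    simp only [hh, true_and] at h3
    change x.1 h = 1 ↔ x.1 (h + g) = 1 at h3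
    have : ∀ a b : Fin 2, (a = 1 ↔ b = 1) → b = a := by decide
    exact hne (this _ _ h3)

/-! ### Greedy anchors with spheres in general position. -/

/-- No face of the sphere of radius `r` around `0` is at distance at most `1` from being coplanar
with a face of the sphere of radius `r'` around `g`. -/
def FarWalls {n : ℕ} (g : Fin n → ℤ) (r r' : ℕ) : Prop :=
  ∀ (i : Fin n) (e e' : ℤˣ), 2 ≤ |(e : ℤ) * r - (g i + e' * r')|

theorem FarWalls.swap {n : ℕ} {g : Fin n → ℤ} {r r' : ℕ} (h : FarWalls g r r') :
    FarWalls (-g) r' r := by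
  intro i e e'
  rw [abs_sub_comm]
  convert h i e' e using 2
  simp only [Pi.neg_apply]; ring

/-- Each cube of side `l` holds at most one point, and `9 ^ n` such cubes suffice. -/
theorem card_le_of_separated {n l : ℕ} (hl : 0 < l) (W : Finset (Fin n → ℤ))
    (hW : ∀ g ∈ W, latticeNorm g ≤ 4 * l)
    (hsep : ∀ g ∈ W, ∀ h ∈ W, g ≠ h → l ≤ latticeNorm (g - h)) : W.card ≤ 9 ^ n := by
  have hl' : (0 : ℤ) < l := by exact_mod_cast hl
  have hcard : (Fintype.piFinset fun _ : Fin n => Finset.Icc (-4 : ℤ) 4).card = 9 ^ n := by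
    simp
  rw [← hcard]
  refine Finset.card_le_card_of_injOn (fun g i => g i / l) ?_ ?_
  · intro g hg
    have := latticeNorm_le.1 (hW g hg)
    simp only [Finset.mem_coe, Fintype.mem_piFinset, Finset.mem_Icc]
    intro i
    have h1 := abs_le.1 (this i)
    push_cast at h1
    exact ⟨(Int.le_ediv_iff_mul_le hl').2 (by linarith),
      Int.ediv_le_of_le_mul hl' (by linarith)⟩
  · intro g hg h hh he
    by_contra hne
    have h1 := hsep g hg h hh hne
    have h2 : latticeNorm (g - h) ≤ l - 1 := by
      rw [latticeNorm_le]
      intro i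
      have h3 : g i / l = h i / l := congrFun he i
      have h4 := Int.emod_add_mul_ediv (g i) l
      have h5 := Int.emod_add_mul_ediv (h i) l
      rw [h3] at h4
      have h6 := Int.emod_nonneg (g i) hl'.ne'
      have h7 := Int.emod_nonneg (h i) hl'.ne'
      have h8 := Int.emod_lt_of_pos (g i) hl'
      have h9 := Int.emod_lt_of_pos (h i) hl'
      rw [Pi.sub_apply, abs_le]
      generalize (l : ℤ) * (h i / l) = z at *
      omega
    omega

/-- Each anchor, axis, pair of signs and error in `{-1, 0, 1}` forbids one radius: at most `9 ^ n *
(n * 12)` of the `l` candidates. -/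
theorem exists_far_radius {n l : ℕ} (hl : 9 ^ n * (n * 12) < l)
    (nb : (Fin n → ℤ) → Option ℕ) (hnb : ∀ g, nb g ≠ none → latticeNorm g ≤ 4 * l)
    (hsep : ∀ g h, nb g ≠ none → nb h ≠ none → g ≠ h → l ≤ latticeNorm (g - h)) :
    ∃ r, l ≤ r ∧ r < 2 * l ∧ ∀ g r', nb g = some r' → FarWalls g r r' := by
  classical
  set W := (finite_latticeNorm_le n (4 * l)).toFinset.filter fun g => nb g ≠ none with hWdef
  have hWm : ∀ g, g ∈ W ↔ nb g ≠ none := fun g => by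
    rw [hWdef, Finset.mem_filter, Set.Finite.mem_toFinset]
    exact ⟨And.right, fun h => ⟨hnb g h, h⟩⟩
  have hW : W.card ≤ 9 ^ n := card_le_of_separated (by omega) W
    (fun g hg => hnb g ((hWm g).1 hg))
    fun g hg h hh => hsep g h ((hWm g).1 hg) ((hWm h).1 hh)
  let P := W ×ˢ ((Finset.univ : Finset (Fin n)) ×ˢ ((Finset.univ : Finset ℤˣ) ×ˢ
    ((Finset.univ : Finset ℤˣ) ×ˢ Finset.Icc (-1 : ℤ) 1)))
  let bad : Finset ℤ := P.image fun q =>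
    (q.2.2.1 : ℤ) * (q.1 q.2.1 + q.2.2.2.1 * ((nb q.1).getD 0 : ℕ) + q.2.2.2.2)
  have hbad : bad.card < (Finset.Ico (l : ℤ) (2 * l)).card := by
    have h1 : bad.card ≤ W.card * (n * 12) := by
      refine Finset.card_image_le.trans (le_of_eq ?_)
      simp only [P, Finset.card_product, Finset.card_univ, Fintype.card_fin, Int.card_Icc,
        Fintype.card_units_int]
      rfl
    have h2 : (Finset.Ico (l : ℤ) (2 * l)).card = l := by rw [Int.card_Ico]; omega
    rw [h2]
    exact (h1.trans (Nat.mul_le_mul_right _ hW)).trans_lt hl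
  obtain ⟨r, hr, hrb⟩ := Finset.exists_mem_notMem_of_card_lt_card hbad
  rw [Finset.mem_Ico] at hr
  lift r to ℕ using by omega
  refine ⟨r, by omega, by omega, fun g r' hg i e e' => ?_⟩
  by_contra hlt
  rw [not_le] at hlt
  apply hrb
  have hgW : g ∈ W := (hWm g).2 (by simp [hg])
  refine Finset.mem_image.2 ⟨(g, i, e, e', (e : ℤ) * r - (g i + e' * r')), ?_, ?_⟩
  · have := abs_le.1 (Int.le_of_lt_add_one (a := |(e : ℤ) * r - (g i + e' * r')|) (b := 1) hlt)
    simp only [P, Finset.mem_product, hgW, Finset.mem_univ, Finset.mem_Icc, this.1, this.2,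
      and_self]
  · have he : (e : ℤ) * e = 1 := by rw [← Units.val_mul, Int.units_mul_self]; rfl
    simp only [hg, Option.getD_some]
    linear_combination (r : ℤ) * he

open Classical in
/-- The greedy choice at `0` given the radii `nb` of the earlier anchors: `0` is made an anchor
unless there is an anchor at distance less than `l`, with a radius in general position. -/
noncomputable def chooseRadius {n : ℕ} (l : ℕ) (nb : (Fin n → ℤ) → Option ℕ) : Option ℕ :=
  if ∃ g, latticeNorm g < l ∧ nb g ≠ none then none
  -- The default `l` is a dummy: `exists_far_radius` supplies a radius wherever the construction is
  -- applied with `l` large.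
  else some (if h : ∃ r, l ≤ r ∧ r < 2 * l ∧ ∀ g r', nb g = some r' → FarWalls g r r'
    then h.choose else l)

theorem chooseRadius_eq_none {n l : ℕ} {nb : (Fin n → ℤ) → Option ℕ} :
    chooseRadius l nb = none ↔ ∃ g, latticeNorm g < l ∧ nb g ≠ none := by
  rw [chooseRadius]; split_ifs with h <;> simp [h]

theorem chooseRadius_spec {n l : ℕ} {nb : (Fin n → ℤ) → Option ℕ} {r : ℕ}
    (h : ∃ r, l ≤ r ∧ r < 2 * l ∧ ∀ g r', nb g = some r' → FarWalls g r r')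
    (hr : chooseRadius l nb = some r) :
    l ≤ r ∧ r < 2 * l ∧ ∀ g r', nb g = some r' → FarWalls g r r' := by
  rw [chooseRadius] at hr
  split_ifs at hr
  obtain rfl := Option.some.inj hr
  exact h.choose_spec

open Classical in
/-- The greedy selection of anchors and radii, in the order given by the index `j`. -/
noncomputable def anchorRadius {n : ℕ} (j : freePart (Fin n → ℤ) → ℕ) (l : ℕ)
    (x : freePart (Fin n → ℤ)) : Option ℕ :=
  chooseRadius l fun g =>
    if h : latticeNorm g ≤ 4 * l ∧ j (freeShift g x) < j x then anchorRadius j l (freeShift g x)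
    else none
termination_by j x
decreasing_by exact h.2

open Classical in
/-- The radii of the anchors near `x` which precede `x`. -/
noncomputable def earlierRadius {n : ℕ} (j : freePart (Fin n → ℤ) → ℕ) (l : ℕ)
    (x : freePart (Fin n → ℤ)) (g : Fin n → ℤ) : Option ℕ :=
  if latticeNorm g ≤ 4 * l ∧ j (freeShift g x) < j x then anchorRadius j l (freeShift g x)
  else none

section anchors

variable {n : ℕ} {j : freePart (Fin n → ℤ) → ℕ} {l : ℕ}

theorem anchorRadius_eq (x : freePart (Fin n → ℤ)) :
    anchorRadius j l x = chooseRadius l (earlierRadius j l x) := by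
  rw [anchorRadius]
  congr 1

theorem earlierRadius_ne_none {x : freePart (Fin n → ℤ)} {g : Fin n → ℤ}
    (h : earlierRadius j l x g ≠ none) :
    latticeNorm g ≤ 4 * l ∧ anchorRadius j l (freeShift g x) ≠ none := by
  rw [earlierRadius] at h
  split_ifs at h with h1
  · exact ⟨h1.1, h⟩
  · exact absurd rfl h

theorem earlierRadius_eq {x : freePart (Fin n → ℤ)} {g : Fin n → ℤ} (h : latticeNorm g ≤ 4 * l)
    (hj : j (freeShift g x) < j x) :
    earlierRadius j l x g = anchorRadius j l (freeShift g x) :=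
  if_pos ⟨h, hj⟩

theorem exists_anchor_near (hl : 0 < l) (x : freePart (Fin n → ℤ)) :
    ∃ g, latticeNorm g < l ∧ anchorRadius j l (freeShift g x) ≠ none := by
  by_cases h : anchorRadius j l x = none
  · rw [anchorRadius_eq, chooseRadius_eq_none] at h
    obtain ⟨g, hg, hne⟩ := h
    exact ⟨g, hg, (earlierRadius_ne_none hne).2⟩
  · exact ⟨0, by rwa [latticeNorm_zero], by rwa [freeShift_zero]⟩

/-- To prove a property of pairs of nearby points of an orbit, the second one may be supposed to
have the smaller index. -/
theorem index_wlog (hj : ∀ x g, g ≠ 0 → latticeNorm g ≤ 4 * l → j (freeShift g x) ≠ j x)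
    {Q : freePart (Fin n → ℤ) → (Fin n → ℤ) → Prop}
    (hswap : ∀ x g, Q (freeShift g x) (-g) → Q x g)
    (h : ∀ x g, g ≠ 0 → latticeNorm g ≤ 4 * l → j (freeShift g x) < j x → Q x g)
    (x : freePart (Fin n → ℤ)) (g : Fin n → ℤ) (hg : g ≠ 0) (hgl : latticeNorm g ≤ 4 * l) :
    Q x g := by
  rcases lt_or_gt_of_ne (hj x g hg hgl) with h1 | h1
  · exact h x g hg hgl h1
  · refine hswap x g (h _ _ (neg_ne_zero.2 hg) (by rwa [latticeNorm_neg]) ?_)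
    rwa [freeShift_freeShift, neg_add_cancel, freeShift_zero]

theorem anchors_separated
    (hj : ∀ x g, g ≠ 0 → latticeNorm g ≤ 4 * l → j (freeShift g x) ≠ j x)
    {x : freePart (Fin n → ℤ)} {g : Fin n → ℤ} (hg : g ≠ 0) (hx : anchorRadius j l x ≠ none)
    (hgx : anchorRadius j l (freeShift g x) ≠ none) : l ≤ latticeNorm g := by
  by_contra! hlt
  refine index_wlog hj (Q := fun x g => latticeNorm g < l → anchorRadius j l x ≠ none →
    anchorRadius j l (freeShift g x) ≠ none → False) ?_ ?_ x g hg (by omega) hlt hx hgx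
  · intro x g h h1 h2 h3
    refine h (by rwa [latticeNorm_neg]) h3 ?_
    rwa [freeShift_freeShift, neg_add_cancel, freeShift_zero]
  · intro x g _ hgl hlt h1 h2 h3
    apply h2
    rw [anchorRadius_eq, chooseRadius_eq_none]
    exact ⟨g, h1, by rwa [earlierRadius_eq hgl hlt]⟩

theorem anchorRadius_spec (hl : 9 ^ n * (n * 12) < l)
    (hj : ∀ x g, g ≠ 0 → latticeNorm g ≤ 4 * l → j (freeShift g x) ≠ j x)
    {x : freePart (Fin n → ℤ)} {r : ℕ} (hx : anchorRadius j l x = some r) :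
    l ≤ r ∧ r < 2 * l ∧ ∀ g r', earlierRadius j l x g = some r' → FarWalls g r r' := by
  rw [anchorRadius_eq] at hx
  refine chooseRadius_spec (exists_far_radius hl _ (fun g hg => (earlierRadius_ne_none hg).1)
    fun g h hg hh hne => ?_) hx
  refine anchors_separated hj (x := freeShift h x) (sub_ne_zero.2 hne)
    (earlierRadius_ne_none hh).2 ?_
  rw [freeShift_freeShift, sub_add_cancel]
  exact (earlierRadius_ne_none hg).2

theorem anchors_farWalls (hl : 9 ^ n * (n * 12) < l)
    (hj : ∀ x g, g ≠ 0 → latticeNorm g ≤ 4 * l → j (freeShift g x) ≠ j x)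
    {x : freePart (Fin n → ℤ)} {g : Fin n → ℤ} (hg : g ≠ 0) (hgl : latticeNorm g ≤ 4 * l)
    {r r' : ℕ} (hx : anchorRadius j l x = some r)
    (hgx : anchorRadius j l (freeShift g x) = some r') : FarWalls g r r' := by
  refine index_wlog hj (Q := fun x g => ∀ r r', anchorRadius j l x = some r →
    anchorRadius j l (freeShift g x) = some r' → FarWalls g r r') ?_ ?_ x g hg hgl r r' hx hgx
  · intro x g h r r' h1 h2
    have := (h r' r h2 (by rwa [freeShift_freeShift, neg_add_cancel, freeShift_zero])).swap
    rwa [neg_neg] at this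
  · intro x g _ hgl hlt r r' h1 h2
    exact (anchorRadius_spec hl hj h1).2.2 g r' (by rwa [earlierRadius_eq hgl hlt])

theorem eventually_index_eq (hc : Continuous j) (N : ℕ) (x : freePart (Fin n → ℤ)) :
    ∀ᶠ y in 𝓝 x, ∀ g, latticeNorm g ≤ N → j (freeShift g y) = j (freeShift g x) :=
  (eventually_all_finite (finite_latticeNorm_le n N)).2 fun g _ =>
    eventually_freeShift x g (hc.eventually_eq_of_discrete _)

/-- The recursion consults finitely many translates, all of smaller index, and the index is locally
constant; hence induction on it. -/
theorem eventually_anchorRadius_eq (hc : Continuous j) (x : freePart (Fin n → ℤ)) :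
    ∀ᶠ y in 𝓝 x, anchorRadius j l y = anchorRadius j l x := by
  induction hm : j x using Nat.strong_induction_on generalizing x with
  | _ m ih =>
    subst hm
    have h1 : ∀ᶠ y in 𝓝 x, ∀ g, latticeNorm g ≤ 4 * l → j (freeShift g x) < j x →
        anchorRadius j l (freeShift g y) = anchorRadius j l (freeShift g x) :=
      (eventually_all_finite (finite_latticeNorm_le n (4 * l))).2 fun g _ => by
        by_cases hlt : j (freeShift g x) < j x
        · filter_upwards [eventually_freeShift x g (ih _ hlt _ rfl)] with y hy _ using hy
        · exact Eventually.of_forall fun y h => absurd h hlt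
    filter_upwards [h1, eventually_index_eq hc (4 * l) x, hc.eventually_eq_of_discrete x]
      with y hy1 hy2 hy3
    rw [anchorRadius_eq, anchorRadius_eq]
    congr 1
    funext g
    rw [earlierRadius, earlierRadius]
    by_cases hg : latticeNorm g ≤ 4 * l
    · rw [hy2 g hg, hy3]
      by_cases hlt : j (freeShift g x) < j x
      · rw [if_pos ⟨hg, hlt⟩, if_pos ⟨hg, hlt⟩, hy1 g hg hlt]
      · rw [if_neg (fun h => hlt h.2), if_neg (fun h => hlt h.2)]
    · rw [if_neg (fun h => hg h.1), if_neg (fun h => hg h.1)]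

end anchors

/-! ### Crossing walls and the four-coloring. -/

theorem latticeNorm_stdGen_le {n : ℕ} (i : Fin n) : latticeNorm (stdGen n i) ≤ 1 := by
  rw [latticeNorm_le]
  intro k
  rw [stdGen, Pi.single_apply]
  split_ifs <;> simp

theorem latticeNorm_eq_iff {n : ℕ} {g : Fin n → ℤ} {r : ℕ} (hr : 0 < r) :
    latticeNorm g = r ↔ (∀ k, |g k| ≤ r) ∧ ∃ k, |g k| = r := by
  constructor
  · rintro rfl
    refine ⟨abs_le_latticeNorm g, ?_⟩
    by_contra! h
    have : latticeNorm g ≤ latticeNorm g - 1 := latticeNorm_le.2 fun k => by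
      have := lt_of_le_of_ne (abs_le_latticeNorm g k) (h k)
      omega
    omega
  · rintro ⟨h1, k, h2⟩
    refine le_antisymm (latticeNorm_le.2 h1) ?_
    have := abs_le_latticeNorm g k
    rw [h2] at this
    exact_mod_cast this

/-- A step in direction `i` which enters or leaves a sphere passes through a face of this sphere
orthogonal to `i`. -/
theorem exists_face_of_cross {n : ℕ} {g : Fin n → ℤ} {i : Fin n} {r : ℕ} (hr : 0 < r)
    (h : ¬ (latticeNorm g = r ↔ latticeNorm (g - stdGen n i) = r)) :
    ∃ e : ℤˣ, (e : ℤ) * r ≤ g i ∧ g i ≤ e * r + 1 := by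
  suffices h' : (r : ℤ) ≤ g i ∧ g i ≤ r + 1 ∨ -(r : ℤ) ≤ g i ∧ g i ≤ -r + 1 by
    rcases h' with h' | h'
    · exact ⟨1, by simpa using h'⟩
    · exact ⟨-1, by simpa using h'⟩
  have split : ∀ f : Fin n → ℤ, (∀ k, k ≠ i → f k = g k) → (latticeNorm f = r ↔
      (∀ k, k ≠ i → |g k| ≤ r) ∧ |f i| ≤ r ∧ ((∃ k, k ≠ i ∧ |g k| = r) ∨ |f i| = r)) := by
    intro f hf
    rw [latticeNorm_eq_iff hr]
    constructor
    · rintro ⟨h1, k, h2⟩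
      refine ⟨fun k hk => hf k hk ▸ h1 k, h1 i, ?_⟩
      rcases eq_or_ne k i with rfl | hk
      · exact Or.inr h2
      · exact Or.inl ⟨k, hk, hf k hk ▸ h2⟩
    · rintro ⟨h1, h2, h3⟩
      refine ⟨fun k => ?_, ?_⟩
      · rcases eq_or_ne k i with rfl | hk
        · exact h2
        · rw [hf k hk]; exact h1 k hk
      · rcases h3 with ⟨k, hk, h3⟩ | h3
        · exact ⟨k, by rw [hf k hk]; exact h3⟩
        · exact ⟨i, h3⟩
  have hi : (g - stdGen n i) i = g i - 1 := by simp [stdGen]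
  rw [split g fun _ _ => rfl, split (g - stdGen n i) fun k hk => by simp [stdGen, hk], hi] at h
  generalize (∀ k, k ≠ i → |g k| ≤ (r : ℤ)) = A at h
  generalize (∃ k, k ≠ i ∧ |g k| = (r : ℤ)) = E at h
  by_contra hcon
  apply h
  have h1 : |g i| ≤ r ↔ |g i - 1| ≤ r := by simp only [abs_le]; omega
  have h2 : |g i| = r ↔ |g i - 1| = r := by simp only [abs_eq (Int.natCast_nonneg r)]; omega
  rw [h1, h2]

/-- This turns "at most one wall is crossed" and "the parity is preserved" into "no wall is
crossed". -/
theorem Finset.eq_of_even_card_iff {α : Type*} {s t : Finset α}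
    (h : ∀ a b, ¬ (a ∈ s ↔ a ∈ t) → ¬ (b ∈ s ↔ b ∈ t) → a = b)
    (hst : Even s.card ↔ Even t.card) : s = t := by
  classical
  by_contra hne
  obtain ⟨a, ha⟩ : ∃ a, ¬ (a ∈ s ↔ a ∈ t) := by
    by_contra! hall
    exact hne (Finset.ext hall)
  have hb : ∀ b, b ≠ a → (b ∈ s ↔ b ∈ t) := fun b hba => by
    by_contra hb
    exact hba (h b a hb ha)
  have key : ∀ u v : Finset α, a ∈ u → a ∉ v → (∀ b, b ≠ a → (b ∈ u ↔ b ∈ v)) →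
      u.card = v.card + 1 := fun u v hu hv huv => by
    rw [← Finset.card_insert_of_notMem hv]
    congr 1
    ext b
    rcases eq_or_ne b a with rfl | hba
    · simp [hu]
    · simp [hba, huv b hba]
  by_cases has : a ∈ s
  · have := key s t has (by tauto) hb
    rw [this, Nat.even_add_one] at hst
    tauto
  · have := key t s (by tauto) has fun b hba => (hb b hba).symm
    rw [this, Nat.even_add_one] at hst
    tauto

section coloring

variable {n : ℕ} {j : freePart (Fin n → ℤ) → ℕ} {l : ℕ}

open Classical in
/-- The anchors whose sphere passes through `x`. -/
noncomputable def wallAnchors (j : freePart (Fin n → ℤ) → ℕ) (l : ℕ)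
    (x : freePart (Fin n → ℤ)) : Finset (Fin n → ℤ) :=
  (finite_latticeNorm_le n (2 * l)).toFinset.filter fun g =>
    anchorRadius j l (freeShift g x) = some (latticeNorm g)

/-- The anchor at `g` relative to `x` has `x` in its closed ball. -/
def Covers (j : freePart (Fin n → ℤ) → ℕ) (l : ℕ) (x : freePart (Fin n → ℤ))
    (g : Fin n → ℤ) : Prop :=
  latticeNorm g ≤ 2 * l ∧ ∃ r, anchorRadius j l (freeShift g x) = some r ∧ latticeNorm g ≤ r

/-- The position of `x` relative to the anchor of least index covering it is even. -/
def EvenPosition (j : freePart (Fin n → ℤ) → ℕ) (l : ℕ) (x : freePart (Fin n → ℤ)) : Prop :=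
  ∃ g, Covers j l x g ∧ (∀ h, Covers j l x h → j (freeShift g x) ≤ j (freeShift h x)) ∧
    Even (∑ i, g i)

theorem mem_wallAnchors {x : freePart (Fin n → ℤ)} {g : Fin n → ℤ} :
    g ∈ wallAnchors j l x ↔ latticeNorm g ≤ 2 * l ∧
      anchorRadius j l (freeShift g x) = some (latticeNorm g) := by
  simp [wallAnchors]

theorem EvenPosition.of_eq {x y : freePart (Fin n → ℤ)}
    (hL : ∀ g, latticeNorm g ≤ 2 * l →
      anchorRadius j l (freeShift g y) = anchorRadius j l (freeShift g x))
    (hj : ∀ g, latticeNorm g ≤ 2 * l → j (freeShift g y) = j (freeShift g x))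
    (h : EvenPosition j l x) : EvenPosition j l y := by
  have hT : ∀ g, Covers j l y g ↔ Covers j l x g := fun g =>
    and_congr_right fun hg => by rw [hL g hg]
  obtain ⟨g, h1, h2, h3⟩ := h
  refine ⟨g, (hT g).2 h1, fun h hh => ?_, h3⟩
  rw [hj g h1.1, hj h hh.1]
  exact h2 h ((hT h).1 hh)

theorem wallAnchors_and_evenPosition_locally_const (hc : Continuous j)
    (x : freePart (Fin n → ℤ)) : ∀ᶠ y in 𝓝 x,
      wallAnchors j l y = wallAnchors j l x ∧ (EvenPosition j l y ↔ EvenPosition j l x) := by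
  have h1 : ∀ᶠ y in 𝓝 x, ∀ g, latticeNorm g ≤ 2 * l →
      anchorRadius j l (freeShift g y) = anchorRadius j l (freeShift g x) :=
    (eventually_all_finite (finite_latticeNorm_le n (2 * l))).2 fun g _ =>
      eventually_freeShift x g (eventually_anchorRadius_eq hc _)
  filter_upwards [h1, eventually_index_eq hc (2 * l) x] with y hL hj
  refine ⟨?_, fun h => h.of_eq (fun g hg => (hL g hg).symm) fun g hg => (hj g hg).symm,
    fun h => h.of_eq hL hj⟩
  ext g
  rw [mem_wallAnchors, mem_wallAnchors]
  exact and_congr_right fun hg => by rw [hL g hg]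

/-- Along an edge which preserves the parity of the number of walls, no wall is crossed. -/
theorem no_wall_crossed (hl : 9 ^ n * (n * 12) < l)
    (hj : ∀ x g, g ≠ 0 → latticeNorm g ≤ 4 * l → j (freeShift g x) ≠ j x)
    (x : freePart (Fin n → ℤ)) (i : Fin n)
    (heven : Even (wallAnchors j l x).card ↔
      Even (wallAnchors j l (freeShift (stdGen n i) x)).card)
    {g : Fin n → ℤ} {r : ℕ} (hg : anchorRadius j l (freeShift g x) = some r) :
    latticeNorm g = r ↔ latticeNorm (g - stdGen n i) = r := by
  classical
  set y := freeShift (stdGen n i) x with hy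
  have hyg : ∀ g, freeShift (g - stdGen n i) y = freeShift g x := fun g => by
    rw [hy, freeShift_freeShift, sub_add_cancel]
  -- The anchors of the walls through `y`, in coordinates relative to `x`.
  set S := (wallAnchors j l y).map (Equiv.addRight (stdGen n i)).toEmbedding with hS
  have hr : ∀ {g r}, anchorRadius j l (freeShift g x) = some r → l ≤ r ∧ r < 2 * l :=
    fun h => ⟨(anchorRadius_spec hl hj h).1, (anchorRadius_spec hl hj h).2.1⟩
  have hmx : ∀ {g r}, anchorRadius j l (freeShift g x) = some r →
      (g ∈ wallAnchors j l x ↔ latticeNorm g = r) := fun {g r} h => by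
    rw [mem_wallAnchors, h, Option.some_inj, eq_comm (a := r)]
    have := hr h
    constructor
    · exact And.right
    · intro h; omega
  have hmS : ∀ {g}, g ∈ S ↔ g - stdGen n i ∈ wallAnchors j l y := fun {g} => by
    rw [hS, Finset.mem_map]
    constructor
    · rintro ⟨a, ha, rfl⟩
      simpa using ha
    · intro h
      exact ⟨_, h, by simp⟩
  have hmy : ∀ {g r}, anchorRadius j l (freeShift g x) = some r →
      (g ∈ S ↔ latticeNorm (g - stdGen n i) = r) := fun {g r} h => by
    rw [hmS, mem_wallAnchors, hyg, h, Option.some_inj, eq_comm (a := r)]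
    have := hr h
    constructor
    · exact And.right
    · intro h; omega
  have hcross : ∀ a, ¬ (a ∈ wallAnchors j l x ↔ a ∈ S) →
      latticeNorm a ≤ 2 * l ∧ ∃ r, anchorRadius j l (freeShift a x) = some r ∧
        ∃ e : ℤˣ, (e : ℤ) * r ≤ a i ∧ a i ≤ e * r + 1 := by
    intro a ha
    obtain ⟨r, hra⟩ : ∃ r, anchorRadius j l (freeShift a x) = some r := by
      by_cases h : a ∈ wallAnchors j l x
      · exact ⟨_, (mem_wallAnchors.1 h).2⟩
      · have h' := (mem_wallAnchors.1 (hmS.1 (show a ∈ S by tauto))).2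
        rw [hyg] at h'
        exact ⟨_, h'⟩
    have hrl := hr hra
    rw [hmx hra, hmy hra] at ha
    refine ⟨?_, r, hra, exists_face_of_cross (by omega) ha⟩
    have h1 := latticeNorm_add_le (a - stdGen n i) (stdGen n i)
    rw [sub_add_cancel] at h1
    have h2 := latticeNorm_stdGen_le i
    by_cases h3 : latticeNorm a = r
    · omega
    · have : latticeNorm (a - stdGen n i) = r := by tauto
      omega
  have heq : wallAnchors j l x = S := by
    refine Finset.eq_of_even_card_iff (fun a b ha hb => ?_) (by rwa [hS, Finset.card_map])
    by_contra hab
    obtain ⟨ha1, r, ha2, e, ha3, ha4⟩ := hcross a ha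
    obtain ⟨hb1, r', hb2, e', hb3, hb4⟩ := hcross b hb
    -- Two crossed walls would have faces orthogonal to `i` within distance `1` of coplanar. The
    -- signs are reversed because `a` and `b` locate the anchors as seen from `x`.
    have hfar := anchors_farWalls hl hj (x := freeShift a x) (g := b - a)
      (sub_ne_zero.2 (Ne.symm hab)) ((latticeNorm_sub_le b a).trans (by omega)) ha2
      (by rwa [freeShift_freeShift, sub_add_cancel]) i (-e) (-e')
    have hle : |((-e : ℤˣ) : ℤ) * r - ((b - a) i + ((-e' : ℤˣ) : ℤ) * r')| ≤ 1 := by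
      rw [abs_le, Pi.sub_apply]
      push_cast
      constructor <;> linarith
    omega
  rw [← hmx hg, ← hmy hg, heq]

theorem evenPosition_stdGen (hl : 9 ^ n * (n * 12) < l)
    (hj : ∀ x g, g ≠ 0 → latticeNorm g ≤ 4 * l → j (freeShift g x) ≠ j x)
    (x : freePart (Fin n → ℤ)) (i : Fin n)
    (heven : Even (wallAnchors j l x).card ↔
      Even (wallAnchors j l (freeShift (stdGen n i) x)).card) :
    ¬ (EvenPosition j l x ↔ EvenPosition j l (freeShift (stdGen n i) x)) := by
  set y := freeShift (stdGen n i) x with hy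
  have hyg : ∀ g, freeShift (g - stdGen n i) y = freeShift g x := fun g => by
    rw [hy, freeShift_freeShift, sub_add_cancel]
  -- Norms change by at most `1` along an edge, so leaving or entering a closed ball changes
  -- membership in its sphere.
  have hT : ∀ g, Covers j l y (g - stdGen n i) ↔ Covers j l x g := by
    intro g
    simp only [Covers, hyg]
    have h1 := latticeNorm_add_le (g - stdGen n i) (stdGen n i)
    rw [sub_add_cancel] at h1
    have h2 := latticeNorm_stdGen_le i
    have h3 := latticeNorm_sub_le g (stdGen n i)
    have key : ∀ r, anchorRadius j l (freeShift g x) = some r → r < 2 * l ∧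
        (latticeNorm (g - stdGen n i) ≤ r ↔ latticeNorm g ≤ r) := fun r hr => by
      have h4 := no_wall_crossed hl hj x i heven hr
      exact ⟨(anchorRadius_spec hl hj hr).2.1, by omega⟩
    constructor
    · rintro ⟨-, r, hr, h⟩
      have := key r hr
      exact ⟨by omega, r, hr, this.2.1 h⟩
    · rintro ⟨-, r, hr, h⟩
      have := key r hr
      exact ⟨by omega, r, hr, this.2.2 h⟩
  have hTy : ∀ g, Covers j l y g ↔ Covers j l x (g + stdGen n i) := fun g => by
    rw [← hT, add_sub_cancel_right]
  have hyg' : ∀ g, freeShift g y = freeShift (g + stdGen n i) x := fun g => by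
    rw [hy, freeShift_freeShift]
  obtain ⟨g₁, hg₁, hg₁'⟩ := exists_anchor_near (j := j) (l := l) (by omega) x
  obtain ⟨r₁, hr₁⟩ := Option.ne_none_iff_exists'.1 hg₁'
  have hr₁' := anchorRadius_spec hl hj hr₁
  obtain ⟨g, hg, hmin⟩ : ∃ g, Covers j l x g ∧
      ∀ h, Covers j l x h → j (freeShift g x) ≤ j (freeShift h x) := by
    have hne : {g | Covers j l x g}.Nonempty := ⟨g₁, by omega, r₁, hr₁, by omega⟩
    exact ⟨_, Function.argminOn_mem (fun g => j (freeShift g x)) _ hne,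
      fun h hh => Function.argminOn_le (fun g => j (freeShift g x)) _ hh⟩
  -- Anchors covering `x` are within `4l` of each other, where the index is injective.
  have huniq : ∀ h, Covers j l x h → (∀ k, Covers j l x k → j (freeShift h x) ≤ j (freeShift k x)) →
      h = g := by
    intro h hh hhmin
    by_contra hne
    apply hj (freeShift g x) (h - g) (sub_ne_zero.2 hne)
      ((latticeNorm_sub_le h g).trans (by have := hg.1; have := hh.1; omega))
    rw [freeShift_freeShift, sub_add_cancel]
    exact le_antisymm (hhmin g hg) (hmin h hh)
  have hx : EvenPosition j l x ↔ Even (∑ k, g k) := by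
    constructor
    · rintro ⟨h, h1, h2, h3⟩
      rwa [← huniq h h1 h2]
    · exact fun h => ⟨g, hg, hmin, h⟩
  have hy' : EvenPosition j l y ↔ Even (∑ k, (g - stdGen n i) k) := by
    constructor
    · rintro ⟨h, h1, h2, h3⟩
      rw [← huniq (h + stdGen n i) ((hTy h).1 h1) fun k hk => ?_, add_sub_cancel_right]
      · exact h3
      · rw [← hyg', ← hyg k]
        exact h2 _ ((hT k).2 hk)
    · refine fun h => ⟨_, (hT g).2 hg, fun k hk => ?_, h⟩
      rw [hyg, hyg']
      exact hmin _ ((hTy k).1 hk)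
  have hsum : ∑ k, (g - stdGen n i) k = ∑ k, g k - 1 := by
    simp [stdGen, Finset.sum_sub_distrib]
  rw [hx, hy', hsum, Int.even_sub_one]
  tauto

end coloring

theorem continuouslyColorable_four (n : ℕ) : ContinuouslyColorable (freeShiftGraph n) 4 := by
  classical
  set l := 9 ^ n * (n * 12) + 1 with hl
  obtain ⟨j, hc, hj⟩ := exists_continuous_index n (4 * l)
  let col : freePart (Fin n → ℤ) → Bool × Bool := fun x =>
    (decide (Even (wallAnchors j l x).card), decide (EvenPosition j l x))
  have hstep : ∀ x i, col x ≠ col (freeShift (stdGen n i) x) := by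
    intro x i h
    obtain ⟨h1, h2⟩ := Prod.ext_iff.1 h
    exact evenPosition_stdGen (by omega) hj x i (decide_eq_decide.1 h1) (decide_eq_decide.1 h2)
  have e : Bool × Bool ≃ Fin 4 := Fintype.equivFinOfCardEq (by simp)
  refine ⟨SimpleGraph.Coloring.mk (fun x => e (col x)) ?_, ?_⟩
  · rintro x y ⟨i, h | h⟩ he
    · have : y = freeShift (stdGen n i) x := Subtype.ext h.symm
      subst this
      exact hstep x i (e.injective he)
    · have : x = freeShift (stdGen n i) y := Subtype.ext h.symm
      subst this
      exact hstep y i (e.injective he.symm)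
  · refine (IsLocallyConstant.iff_eventually_eq _ |>.2 fun x => ?_).continuous
    filter_upwards [wallAnchors_and_evenPosition_locally_const (l := l) hc x] with y hy
    change e (col y) = e (col x)
    simp only [col, hy.1, hy.2]

theorem ContinuouslyColorable.mono {V : Type*} [TopologicalSpace V] {Γ : SimpleGraph V} {k m : ℕ}
    (hkm : k ≤ m) (h : ContinuouslyColorable Γ k) : ContinuouslyColorable Γ m := by
  obtain ⟨c, hc⟩ := h
  exact ⟨SimpleGraph.Coloring.mk (fun x => Fin.castLE hkm (c x)) fun h he =>
    c.valid h (Fin.castLE_injective hkm he),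
    (continuous_of_discreteTopology (f := Fin.castLE hkm)).comp hc⟩

theorem mainTheorem2 :
    (¬ ∃ c : (freeShiftGraph 2).Coloring (Fin 3), Continuous c) ∧
    (∀ n : ℕ, 2 ≤ n → continuousChromaticNumber (freeShiftGraph n) = 4) := by
  refine ⟨not_continuouslyColorable_three (i₀ := (0 : Fin 2)) (i₁ := 1) (by decide),
    fun n hn => le_antisymm ?_ ?_⟩
  · exact iInf₂_le 4 (continuouslyColorable_four n)
  · refine le_iInf₂ fun k hk => ?_
    have hi : (⟨1, hn⟩ : Fin n) ≠ ⟨0, by omega⟩ := by simp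
    by_contra hlt
    have hk4 : k < 4 := by exact_mod_cast not_le.1 hlt
    exact not_continuouslyColorable_three hi (ContinuouslyColorable.mono (by omega) hk)
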